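/- All rings are commutative with identity. A ring $R$ is said to satisfy the symmetric Auslander condition (SAC) if for every finitely generated $R$-module $M$ such that $\operatorname{Ext}_R^{i}(M,R)=0$ for all $i>0$ and $\operatorname{Ext}_R^{i}(M,M)=0$ for all sufficiently large $i$, one has $\operatorname{Ext}_R^{i}(M,M)=0$ for all $i>0$. Let $(R,\mathfrak m)$ be a Noetherian local ring and let $\widehat R$ denote its $\mathfrak m$-adic completion. Then $R$ satisfies (SAC) if and only if $\widehat R$ satisfies (SAC). -/

import Mathlib

open CategoryTheory

/-- The symmetric Auslander condition (SAC) for a commutative ring `R`: for every finitely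
generated `R`-module `M`, if `Ext^i_R(M, R) = 0` for all `i > 0` and `Ext^i_R(M, M) = 0` for all
sufficiently large `i`, then `Ext^i_R(M, M) = 0` for all `i > 0`.
Every finitely generated `R`-module is isomorphic to one in the universe of `R`. -/
def SatisfiesSAC.{u} (R : Type u) [CommRing R] : Prop :=
  ∀ (M : Type u) [AddCommGroup M] [Module R M] [Module.Finite R M],
    (∀ i : ℕ, 0 < i → Subsingleton (Abelian.Ext (ModuleCat.of R M) (ModuleCat.of R R) i)) →
    (∃ n : ℕ, ∀ i : ℕ, n < i →
      Subsingleton (Abelian.Ext (ModuleCat.of R M) (ModuleCat.of R M) i)) →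
    ∀ i : ℕ, 0 < i → Subsingleton (Abelian.Ext (ModuleCat.of R M) (ModuleCat.of R M) i)

-- Write `S` for the completion. It is faithfully flat over `R`, so vanishing of Ext in positive
-- degrees between finitely generated modules is both preserved and reflected by `S ⊗ -`
-- (`extVanishes_baseChange_iff`). Hence (SAC) descends from `S` to `R`.
--
-- Conversely, a failure of (SAC) over `S` is a finite module `M` with Ext^i(M, S) = 0 for `i > 0`
-- and a largest degree `s > 0` with Ext^s(M, M) nonzero (`HasTopSelfExt`). Such an `M` need not
-- come from `R`, so it is replaced by a module that does. In a free resolution of `M`, take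
-- successive cones of multiplication by generators of the maximal ideal: the homology becomes
-- torsion for a power of that ideal. A cone turns a high cokernel `M` into the kernel of a
-- surjection `F × M → M` with `F` free, acting on `M` as an element of the radical. Nakayama's
-- lemma for Ext shows that the top degree rises by exactly one (`HasTopSelfExt.of_exact`), so the
-- failure survives.
--
-- A complex of finite free `S`-modules, bounded below, with homology killed by a power `I` of the
-- maximal ideal has cokernels that are extended from `R` up to a free summand
-- (`FreeComplex.isStablyExtended_coker`). Indeed syzygies keep this property by Schanuel's lemma,
-- and kernels killed by `I` cause no obstruction because `R` surjects onto `S/IS`. Free summands do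
-- not affect the top degree, so faithful flatness yields a failure over `R`.

universe u

/-! ### Completions of Noetherian local rings -/

namespace AdicCompletion
open IsLocalRing

/-- The completion is a quotient of a power series ring over `R`, the variables going to generators
of the maximal ideal. -/
theorem isNoetherianRing_of_isLocalRing (R : Type*) [CommRing R] [IsNoetherianRing R]
    [IsLocalRing R] : IsNoetherianRing (AdicCompletion (maximalIdeal R) R) := by
  let S := AdicCompletion (maximalIdeal R) R
  obtain ⟨s, hs⟩ := (maximalIdeal R).fg_of_isNoetherianRing
  -- With the discrete uniformity on `R`, `algebraMap R S` is continuous, as evaluation of power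
  -- series requires.
  let : UniformSpace R := ⊥
  have : DiscreteTopology R := ⟨rfl⟩
  let : WithIdeal S := ⟨maximalIdeal S⟩
  have hc : CompleteSpace S ∧ T2Space S :=
    (IsAdic.isAdicComplete_iff (I := maximalIdeal S) rfl).mp inferInstance
  have := hc.1
  have := hc.2
  let a : s → S := fun i ↦ algebraMap R S i
  have hS : maximalIdeal S = Ideal.span (Set.range a) := by
    have : (maximalIdeal R).map (algebraMap R S) = (Ideal.span (s : Set R)).map (algebraMap R S) :=
      by rw [hs]
    rw [AdicCompletion.maximalIdeal_eq_map, this, Ideal.map_span]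
    congr 1
    ext y
    simp [a]
  have ha : MvPowerSeries.HasEval a :=
    ⟨fun i ↦ WithIdeal.isTopologicallyNilpotent_of_mem
      (show a i ∈ maximalIdeal S from hS ▸ Ideal.subset_span ⟨i, rfl⟩),
      by simp [Filter.cofinite_eq_bot]⟩
  have hφ : Continuous (algebraMap R S) := continuous_of_discreteTopology
  let f : MvPowerSeries s R →+* S := MvPowerSeries.eval₂Hom hφ ha
  have hX : ∀ i, f (MvPowerSeries.X i) = a i := fun i ↦ by
    simp [f, MvPowerSeries.coe_eval₂Hom]
  have hC : ∀ r, f (MvPowerSeries.C r) = algebraMap R S r := fun r ↦ by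
    simp [f, MvPowerSeries.coe_eval₂Hom]
  have hI : (Ideal.span (Set.range (MvPowerSeries.X (σ := s) (R := R)))).map f
      = maximalIdeal S := by
    rw [hS, Ideal.map_span, ← Set.range_comp]
    congr 2
    exact funext hX
  have : IsHausdorff ((Ideal.span (Set.range (MvPowerSeries.X (σ := s) (R := R)))).map f) S := by
    rw [hI]; infer_instance
  -- By completeness it suffices to be surjective modulo the ideal of the variables, where constants
  -- already fill the residue field.
  have hsurj : Function.Surjective f := by
    apply surjective_of_mk_map_comp_surjective
      (I := Ideal.span (Set.range (MvPowerSeries.X (σ := s) (R := R)))) f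
    rw [hI]
    intro y
    obtain ⟨r, hr⟩ := (residueField_map_bijective R).2 y
    obtain ⟨r, rfl⟩ := residue_surjective r
    refine ⟨MvPowerSeries.C r, ?_⟩
    rw [← hr, RingHom.comp_apply, hC]
    rfl
  exact isNoetherianRing_of_surjective _ _ f hsurj

theorem faithfullyFlat_of_isLocalRing (R : Type*) [CommRing R] [IsNoetherianRing R]
    [IsLocalRing R] : Module.FaithfullyFlat R (AdicCompletion (maximalIdeal R) R) :=
  Module.FaithfullyFlat.of_flat_of_isLocalHom

theorem exists_sub_algebraMap_mem_map_pow (R : Type*) [CommRing R] [IsNoetherianRing R]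
    [IsLocalRing R] (k : ℕ) (y : AdicCompletion (maximalIdeal R) R) :
    ∃ r : R, y - algebraMap R _ r ∈ ((maximalIdeal R) ^ k).map (algebraMap R
      (AdicCompletion (maximalIdeal R) R)) := by
  obtain ⟨r, hr⟩ := Ideal.Quotient.mk_surjective (y.1 k)
  refine ⟨r, ?_⟩
  rw [← Submodule.restrictScalars_mem R, ← Ideal.smul_top_eq_map,
    AdicCompletion.pow_smul_top_eq_ker_eval (maximalIdeal R).fg_of_isNoetherianRing,
    AdicCompletion.algebraMap_apply]
  simpa [eval, sub_eq_zero] using hr.symm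

end AdicCompletion

/-! ### Vanishing of Ext and the top self-extension degree -/

section ExtVanishing

open Abelian

/-- The vanishing of `Ext^i_R(A, B)`. -/
abbrev ExtVanishes (R : Type u) [CommRing R] (A B : Type u) [AddCommGroup A] [Module R A]
    [AddCommGroup B] [Module R B] (i : ℕ) : Prop :=
  Subsingleton (Ext (ModuleCat.of R A) (ModuleCat.of R B) i)

variable {R : Type u} [CommRing R]
  {A A' B B' C : Type u} [AddCommGroup A] [Module R A] [AddCommGroup A'] [Module R A']
  [AddCommGroup B] [Module R B] [AddCommGroup B'] [Module R B'] [AddCommGroup C] [Module R C]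

namespace ExtVanishes

theorem of_forall_eq_zero {i : ℕ}
    (h : ∀ x : Ext (ModuleCat.of R A) (ModuleCat.of R B) i, x = 0) : ExtVanishes R A B i :=
  ⟨fun x y ↦ (h x).trans (h y).symm⟩

theorem of_retract_left {i : ℕ} (f : A' →ₗ[R] A) (g : A →ₗ[R] A') (hgf : g ∘ₗ f = .id)
    (h : ExtVanishes R A B i) : ExtVanishes R A' B i := by
  refine of_forall_eq_zero fun x ↦ ?_
  have : x = (Ext.mk₀ (ModuleCat.ofHom f)).comp
      ((Ext.mk₀ (ModuleCat.ofHom g)).comp x (zero_add i)) (zero_add i) := by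
    rw [Ext.mk₀_comp_mk₀_assoc, ← ModuleCat.ofHom_comp, hgf]
    exact (Ext.mk₀_id_comp x).symm
  rw [this, Subsingleton.elim ((Ext.mk₀ (ModuleCat.ofHom g)).comp x (zero_add i)) 0,
    Ext.comp_zero]

theorem of_retract_right {i : ℕ} (f : B' →ₗ[R] B) (g : B →ₗ[R] B') (hgf : g ∘ₗ f = .id)
    (h : ExtVanishes R A B i) : ExtVanishes R A B' i := by
  refine of_forall_eq_zero fun x ↦ ?_
  have : x = (x.comp (Ext.mk₀ (ModuleCat.ofHom f)) (add_zero i)).comp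
      (Ext.mk₀ (ModuleCat.ofHom g)) (add_zero i) := by
    rw [Ext.comp_assoc_of_second_deg_zero, Ext.mk₀_comp_mk₀, ← ModuleCat.ofHom_comp, hgf]
    exact (Ext.comp_mk₀_id x).symm
  rw [this, Subsingleton.elim (x.comp (Ext.mk₀ (ModuleCat.ofHom f)) (add_zero i)) 0,
    Ext.zero_comp]

theorem congr {i : ℕ} (e : A ≃ₗ[R] A') (e' : B ≃ₗ[R] B') (h : ExtVanishes R A B i) :
    ExtVanishes R A' B' i :=
  of_retract_left (e.symm : A' →ₗ[R] A) (e : A →ₗ[R] A') (by ext; simp)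
    (of_retract_right (e'.symm : B' →ₗ[R] B) (e' : B →ₗ[R] B') (by ext; simp) h)

theorem inl_comp_fst_add_inr_comp_snd :
    LinearMap.inl R A A' ∘ₗ .fst R A A' + LinearMap.inr R A A' ∘ₗ .snd R A A' = .id := by
  ext <;> simp

theorem eq_fst_comp_add_snd_comp {i : ℕ}
    (x : Ext (ModuleCat.of R (A × A')) (ModuleCat.of R B) i) :
    x = (Ext.mk₀ (ModuleCat.ofHom (.fst R A A'))).comp
        ((Ext.mk₀ (ModuleCat.ofHom (.inl R A A'))).comp x (zero_add i)) (zero_add i) +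
      (Ext.mk₀ (ModuleCat.ofHom (.snd R A A'))).comp
        ((Ext.mk₀ (ModuleCat.ofHom (.inr R A A'))).comp x (zero_add i)) (zero_add i) := by
  rw [Ext.mk₀_comp_mk₀_assoc, Ext.mk₀_comp_mk₀_assoc, ← Ext.add_comp, ← Ext.mk₀_add,
    ← ModuleCat.ofHom_comp, ← ModuleCat.ofHom_comp, ← ModuleCat.ofHom_add,
    inl_comp_fst_add_inr_comp_snd]
  exact (Ext.mk₀_id_comp x).symm

theorem eq_comp_inl_add_comp_inr {i : ℕ}
    (x : Ext (ModuleCat.of R A) (ModuleCat.of R (B × B')) i) :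
    x = (x.comp (Ext.mk₀ (ModuleCat.ofHom (.fst R B B'))) (add_zero i)).comp
        (Ext.mk₀ (ModuleCat.ofHom (.inl R B B'))) (add_zero i) +
      (x.comp (Ext.mk₀ (ModuleCat.ofHom (.snd R B B'))) (add_zero i)).comp
        (Ext.mk₀ (ModuleCat.ofHom (.inr R B B'))) (add_zero i) := by
  rw [Ext.comp_assoc_of_second_deg_zero, Ext.comp_assoc_of_second_deg_zero,
    Ext.mk₀_comp_mk₀, Ext.mk₀_comp_mk₀, ← Ext.comp_add, ← Ext.mk₀_add,
    ← ModuleCat.ofHom_comp, ← ModuleCat.ofHom_comp, ← ModuleCat.ofHom_add,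
    inl_comp_fst_add_inr_comp_snd]
  exact (Ext.comp_mk₀_id x).symm

theorem prod_left {i : ℕ} (h : ExtVanishes R A B i) (h' : ExtVanishes R A' B i) :
    ExtVanishes R (A × A') B i := by
  refine of_forall_eq_zero fun x ↦ ?_
  rw [eq_fst_comp_add_snd_comp x,
    Subsingleton.elim ((Ext.mk₀ (ModuleCat.ofHom (.inl R A A'))).comp x (zero_add i)) 0,
    Subsingleton.elim ((Ext.mk₀ (ModuleCat.ofHom (.inr R A A'))).comp x (zero_add i)) 0]
  simp

theorem prod_right {i : ℕ} (h : ExtVanishes R A B i) (h' : ExtVanishes R A B' i) :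
    ExtVanishes R A (B × B') i := by
  refine of_forall_eq_zero fun x ↦ ?_
  rw [eq_comp_inl_add_comp_inr x,
    Subsingleton.elim (x.comp (Ext.mk₀ (ModuleCat.ofHom (.fst R B B'))) (add_zero i)) 0,
    Subsingleton.elim (x.comp (Ext.mk₀ (ModuleCat.ofHom (.snd R B B'))) (add_zero i)) 0]
  simp

theorem of_projective [Module.Projective R A] {i : ℕ} (hi : 0 < i) : ExtVanishes R A B i := by
  obtain ⟨i, rfl⟩ := Nat.exists_eq_succ_of_ne_zero hi.ne'
  have : Projective (ModuleCat.of R A) := (IsProjective.iff_projective A).mp inferInstance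
  exact of_forall_eq_zero fun x ↦ x.eq_zero_of_projective

theorem of_subsingleton_right [Subsingleton B] {i : ℕ} : ExtVanishes R A B i := by
  refine of_forall_eq_zero fun x ↦ ?_
  rw [← Ext.comp_mk₀_id x, show 𝟙 (ModuleCat.of R B) = 0 from
    ModuleCat.hom_ext (LinearMap.ext fun _ ↦ Subsingleton.elim _ _)]
  simp

theorem pi_right {i : ℕ} (h : ExtVanishes R A R i) (n : ℕ) : ExtVanishes R A (Fin n → R) i := by
  induction n with
  | zero => exact of_subsingleton_right
  | succ n ih => exact congr (.refl R A) (Fin.consLinearEquiv R fun _ ↦ R) (prod_right h ih)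

theorem free_right [Module.Finite R B] [Module.Free R B] {i : ℕ} (h : ExtVanishes R A R i) :
    ExtVanishes R A B i := by
  let b := Module.Free.chooseBasis R B
  exact congr (.refl R A) ((b.reindex (Fintype.equivFin _)).equivFun.symm) (pi_right h _)

end ExtVanishes

namespace Function.Exact

variable {f : A →ₗ[R] B} {g : B →ₗ[R] C}

/-- The short exact sequence of objects of `ModuleCat` attached to a short exact sequence of
linear maps. -/
theorem shortExact (h : Function.Exact f g) (hf : Function.Injective f)
    (hg : Function.Surjective g) :
    (ModuleCat.shortComplexOfCompEqZero f g h.linearMap_comp_eq_zero).ShortExact :=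
  ModuleCat.shortComplex_shortExact _ h hf hg

variable (h : Function.Exact f g) (hf : Function.Injective f) (hg : Function.Surjective g)
include h hf hg

theorem extVanishes_covariant_first {D : Type u} [AddCommGroup D] [Module R D] {i : ℕ}
    (h₃ : ExtVanishes R D C i) (h₂ : ExtVanishes R D B (i + 1)) : ExtVanishes R D A (i + 1) := by
  refine .of_forall_eq_zero fun x ↦ ?_
  obtain ⟨y, rfl⟩ := Ext.covariant_sequence_exact₁ _ (h.shortExact hf hg) x
    (Subsingleton.elim (α := Ext (ModuleCat.of R D) (ModuleCat.of R B) (i + 1)) _ _) rfl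
  rw [Subsingleton.elim (α := Ext (ModuleCat.of R D) (ModuleCat.of R C) i) y 0, Ext.zero_comp]

theorem extVanishes_contravariant_first {D : Type u} [AddCommGroup D] [Module R D] {i : ℕ}
    (h₂ : ExtVanishes R B D i) (h₃ : ExtVanishes R C D (i + 1)) : ExtVanishes R A D i := by
  refine .of_forall_eq_zero fun x ↦ ?_
  obtain ⟨y, rfl⟩ := Ext.contravariant_sequence_exact₁ (h.shortExact hf hg) _ x (add_comm 1 i)
    (Subsingleton.elim (α := Ext (ModuleCat.of R C) (ModuleCat.of R D) (i + 1)) _ _)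
  rw [Subsingleton.elim (α := Ext (ModuleCat.of R B) (ModuleCat.of R D) i) y 0, Ext.comp_zero]

theorem extVanishes_contravariant_third {D : Type u} [AddCommGroup D] [Module R D] {i : ℕ}
    (h₁ : ExtVanishes R A D i) (h₂ : ExtVanishes R B D (i + 1)) : ExtVanishes R C D (i + 1) := by
  refine .of_forall_eq_zero fun x ↦ ?_
  obtain ⟨y, rfl⟩ := Ext.contravariant_sequence_exact₃ (h.shortExact hf hg) _ x
    (Subsingleton.elim (α := Ext (ModuleCat.of R B) (ModuleCat.of R D) (i + 1)) _ _) (add_comm 1 i)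
  rw [Subsingleton.elim (α := Ext (ModuleCat.of R A) (ModuleCat.of R D) i) y 0, Ext.comp_zero]

end Function.Exact

/-- Nakayama's lemma, in the form used below for Ext modules. -/
theorem subsingleton_of_forall_eq_smul_of_mem_jacobson {M : Type*} [AddCommGroup M] [Module R M]
    [Module.Finite R M] {x : R} (hx : x ∈ (⊥ : Ideal R).jacobson)
    (h : ∀ z : M, ∃ y, z = x • y) : Subsingleton M := by
  rw [← Submodule.subsingleton_iff R, ← subsingleton_iff_bot_eq_top, eq_comm]
  refine Submodule.eq_bot_of_le_smul_of_le_jacobson_bot (Ideal.span {x}) _ Module.Finite.fg_top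
    (fun z _ ↦ ?_) ((Ideal.span_singleton_le_iff_mem _).mpr hx)
  obtain ⟨y, rfl⟩ := h z
  exact Submodule.smul_mem_smul (Ideal.mem_span_singleton_self x) trivial

/-- The top nonvanishing positive self-extension degree of a module which is `Ext`-orthogonal to
the ring is `s`. -/
structure HasTopSelfExt (R : Type u) [CommRing R] (M : Type u) [AddCommGroup M] [Module R M]
    (s : ℕ) : Prop where
  pos : 0 < s
  ring : ∀ i, 0 < i → ExtVanishes R M R i
  above : ∀ i, s < i → ExtVanishes R M M i
  top : ¬ ExtVanishes R M M s

/-- A free summand contributes only Ext out of a projective and Ext(M, R), both zero in positive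
degrees. -/
theorem HasTopSelfExt.prod_free {M F : Type u} [AddCommGroup M] [Module R M] [AddCommGroup F]
    [Module R F] [Module.Finite R F] [Module.Free R F] {s : ℕ} (h : HasTopSelfExt R M s) :
    HasTopSelfExt R (M × F) s where
  pos := h.pos
  ring i hi := .prod_left (h.ring i hi) (.of_projective hi)
  above i hi := .prod_left (.prod_right (h.above i hi)
    (.free_right (h.ring i (h.pos.trans hi)))) (.of_projective (h.pos.trans hi))
  top h' := h.top <| .of_retract_left (.inl R M F) (.fst R M F) (by ext; simp) <|
    .of_retract_right (.inl R M F) (.fst R M F) (by ext; simp) h'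

theorem HasTopSelfExt.congr {M N : Type u} [AddCommGroup M] [Module R M] [AddCommGroup N]
    [Module R N] {s : ℕ} (e : M ≃ₗ[R] N) (h : HasTopSelfExt R M s) : HasTopSelfExt R N s where
  pos := h.pos
  ring i hi := (h.ring i hi).congr e (.refl R R)
  above i hi := (h.above i hi).congr e e
  top h' := h.top (h'.congr e.symm e.symm)

/-- Two long exact sequences, with Ext^(s+1)(M, N) as intermediary. The maps they induce between Ext
groups are multiplication by `x`, so vanishing one degree too early would contradict Nakayama's
lemma. -/
theorem HasTopSelfExt.of_exact [IsNoetherianRing R] {M N F : Type u} [AddCommGroup M] [Module R M]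
    [AddCommGroup N] [Module R N] [AddCommGroup F] [Module R F] [Module.Finite R F]
    [Module.Free R F] [Module.Finite R M] {f : N →ₗ[R] F × M} {g : F × M →ₗ[R] M}
    (hfg : Function.Exact f g) (hf : Function.Injective f) (hg : Function.Surjective g)
    {x : R} (hx : x ∈ (⊥ : Ideal R).jacobson) (hgx : g ∘ₗ .inr R F M = x • .id)
    {s : ℕ} (h : HasTopSelfExt R M s) : HasTopSelfExt R N (s + 1) := by
  have : Module.Finite R N := .of_injective f hf
  have hMN : ∀ i, s + 1 < i → ExtVanishes R M N i := fun i hi ↦ by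
    obtain ⟨j, rfl⟩ := Nat.exists_eq_succ_of_ne_zero (by lia : i ≠ 0)
    have hj : s < j := by lia
    exact hfg.extVanishes_covariant_first hf hg (h.above j hj)
      (.prod_right (.free_right (h.ring _ (by lia))) (h.above _ (by lia)))
  have hx' : Ext.mk₀ (ModuleCat.ofHom (g ∘ₗ .inr R F M)) =
      x • Ext.mk₀ (𝟙 (ModuleCat.of R M)) := by
    rw [hgx, ← Ext.mk₀_smul]; rfl
  have hMN' : ¬ ExtVanishes R M N (s + 1) := fun hv ↦ by
    -- The class `z` lifts along `g`; the `F`-component of the lift vanishes and `g` is `x` on `M`,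
    -- so `z` is a multiple of `x`.
    refine h.top (subsingleton_of_forall_eq_smul_of_mem_jacobson hx fun z ↦ ?_)
    obtain ⟨y, hy⟩ := Ext.covariant_sequence_exact₃ (ModuleCat.of R M) (hfg.shortExact hf hg) z rfl
      (Subsingleton.elim (α := Ext (ModuleCat.of R M) (ModuleCat.of R N) (s + 1)) _ _)
    change y.comp (Ext.mk₀ (ModuleCat.ofHom g)) _ = z at hy
    have := (ExtVanishes.free_right (B := F) (h.ring s h.pos))
    have hy' := ExtVanishes.eq_comp_inl_add_comp_inr y
    rw [Subsingleton.elim (y.comp (Ext.mk₀ (ModuleCat.ofHom (.fst R F M))) (add_zero s)) 0,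
      Ext.zero_comp, zero_add] at hy'
    refine ⟨y.comp (Ext.mk₀ (ModuleCat.ofHom (.snd R F M))) (add_zero s), ?_⟩
    rw [← hy]
    conv_lhs => rw [hy']
    rw [Ext.comp_assoc_of_second_deg_zero _ (Ext.mk₀ (ModuleCat.ofHom (.inr R F M))),
      Ext.mk₀_comp_mk₀, ← ModuleCat.ofHom_comp, hx', Ext.comp_smul, Ext.comp_mk₀_id]
  refine ⟨by lia, fun i hi ↦ ?_, fun i hi ↦ ?_, fun hv ↦ ?_⟩
  · exact hfg.extVanishes_contravariant_first hf hg
      (.prod_left (.of_projective hi) (h.ring i hi)) (h.ring _ (by lia))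
  · exact hfg.extVanishes_contravariant_first hf hg
      (.prod_left (.of_projective (by lia)) (hMN i hi)) (hMN _ (by lia))
  -- Pulled back to `F × M`, `w` restricts to zero on `N`, hence factors through `g`; restriction to
  -- the summand `M` then gives `w = x • y`.
  · refine hMN' (subsingleton_of_forall_eq_smul_of_mem_jacobson hx fun w ↦ ?_)
    obtain ⟨y, hy⟩ := Ext.contravariant_sequence_exact₂ (hfg.shortExact hf hg) (ModuleCat.of R N)
      ((Ext.mk₀ (ModuleCat.ofHom (.snd R F M))).comp w (zero_add _))
      (Subsingleton.elim (α := Ext (ModuleCat.of R N) (ModuleCat.of R N) (s + 1)) _ _)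
    change (Ext.mk₀ (ModuleCat.ofHom g)).comp y _ = _ at hy
    refine ⟨y, ?_⟩
    have := congr((Ext.mk₀ (ModuleCat.ofHom (.inr R F M))).comp $hy (zero_add _))
    rw [Ext.mk₀_comp_mk₀_assoc, Ext.mk₀_comp_mk₀_assoc, ← ModuleCat.ofHom_comp,
      ← ModuleCat.ofHom_comp, hx', Ext.smul_comp, Ext.mk₀_id_comp] at this
    rw [this, LinearMap.snd_comp_inr]
    exact (Ext.mk₀_id_comp w).symm

end ExtVanishing

/-! ### Ext and faithfully flat base change -/

section FlatBaseChange

open Abelian TensorProduct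

section

variable {R : Type u} [CommRing R]
  {K F A B : Type u} [AddCommGroup K] [Module R K] [AddCommGroup F] [Module R F]
  [AddCommGroup A] [Module R A] [AddCommGroup B] [Module R B]
  {f : K →ₗ[R] F} {g : F →ₗ[R] A}

theorem Function.Exact.extVanishes_one_iff [Module.Projective R F] (h : Function.Exact f g)
    (hf : Function.Injective f) (hg : Function.Surjective g) :
    ExtVanishes R A B 1 ↔ ∀ φ : K →ₗ[R] B, ∃ ψ : F →ₗ[R] B, ψ ∘ₗ f = φ := by
  refine ⟨fun hv φ ↦ ?_, fun H ↦ .of_forall_eq_zero fun x ↦ ?_⟩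
  · obtain ⟨y, hy⟩ := Ext.contravariant_sequence_exact₁ (h.shortExact hf hg) (ModuleCat.of R B)
      (Ext.mk₀ (ModuleCat.ofHom φ)) (add_comm 1 0)
      (Subsingleton.elim (α := Ext (ModuleCat.of R A) (ModuleCat.of R B) 1) _ _)
    obtain ⟨ψ, rfl⟩ := (Ext.mk₀_bijective _ _).2 y
    rw [Ext.mk₀_comp_mk₀] at hy
    exact ⟨ψ.hom, congr(ModuleCat.Hom.hom $((Ext.mk₀_bijective _ _).1 hy))⟩
  · have : ExtVanishes R F B 1 := .of_projective one_pos
    obtain ⟨y, rfl⟩ := Ext.contravariant_sequence_exact₃ (h.shortExact hf hg) (ModuleCat.of R B)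
      x (Subsingleton.elim (α := Ext (ModuleCat.of R F) (ModuleCat.of R B) 1) _ _) (add_comm 1 0)
    obtain ⟨φ, rfl⟩ := (Ext.mk₀_bijective _ _).2 y
    obtain ⟨ψ, hψ⟩ := H φ.hom
    have : φ = ModuleCat.ofHom f ≫ ModuleCat.ofHom ψ := by
      rw [← ModuleCat.ofHom_comp, hψ]; rfl
    rw [this, ← Ext.mk₀_comp_mk₀]
    exact (h.shortExact hf hg).extClass_comp_assoc _

theorem Function.Exact.extVanishes_add_two_iff [Module.Projective R F] (h : Function.Exact f g)
    (hf : Function.Injective f) (hg : Function.Surjective g) (i : ℕ) :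
    ExtVanishes R A B (i + 1 + 1) ↔ ExtVanishes R K B (i + 1) :=
  ⟨fun hv ↦ h.extVanishes_contravariant_first hf hg (.of_projective i.succ_pos) hv,
    fun hv ↦ h.extVanishes_contravariant_third hf hg hv (.of_projective (i + 1).succ_pos)⟩

/-- Expressing the vanishing as exactness of a Hom sequence makes it accessible to faithfully flat
descent. -/
theorem extVanishes_one_iff_exact {G G' : Type u} [AddCommGroup G] [Module R G]
    [AddCommGroup G'] [Module R G'] [Module.Projective R F] {d₂ : G' →ₗ[R] G} {d₁ : G →ₗ[R] F}
    (h₂ : Function.Exact d₂ d₁) (h₁ : Function.Exact d₁ g) (hg : Function.Surjective g) :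
    ExtVanishes R A B 1 ↔ Function.Exact (d₁.lcomp R B) (d₂.lcomp R B) := by
  have hk : Function.Exact (LinearMap.ker g).subtype g := fun x ↦ by simp
  rw [hk.extVanishes_one_iff (Submodule.subtype_injective _) hg]
  let d : G →ₗ[R] LinearMap.ker g := d₁.codRestrict _ h₁.apply_apply_eq_zero
  have hd : Function.Surjective d := fun ⟨y, hy⟩ ↦ by
    obtain ⟨x, rfl⟩ := (h₁ y).mp hy
    exact ⟨x, rfl⟩
  have hd₂ : Function.Exact d₂ d := fun x ↦ by
    rw [← h₂ x]
    exact Subtype.ext_iff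
  refine ⟨fun H φ ↦ ⟨fun hφ ↦ ?_, ?_⟩, fun H φ ↦ ?_⟩
  · have hle : LinearMap.ker d ≤ LinearMap.ker φ := fun x hx ↦ by
      obtain ⟨y, rfl⟩ := (hd₂ x).mp hx
      exact LinearMap.congr_fun hφ y
    obtain ⟨φ', hφ'⟩ : ∃ φ' : LinearMap.ker g →ₗ[R] B, φ' ∘ₗ d = φ :=
      ⟨(LinearMap.ker d).liftQ φ hle ∘ₗ (d.quotKerEquivOfSurjective hd).symm, by
        ext x
        have : (d.quotKerEquivOfSurjective hd).symm (d x) = Submodule.Quotient.mk x := by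
          rw [LinearEquiv.symm_apply_eq]; rfl
        simp [this]⟩
    obtain ⟨ψ, hψ⟩ := H φ'
    refine ⟨ψ, ?_⟩
    rw [← hφ', ← hψ]; rfl
  · rintro ⟨ψ, rfl⟩
    ext x
    simp [h₂.apply_apply_eq_zero]
  · obtain ⟨ψ, hψ⟩ := (H (φ ∘ₗ d)).mp (by ext x; simp [hd₂.apply_apply_eq_zero])
    refine ⟨ψ, ?_⟩
    ext y
    obtain ⟨x, rfl⟩ := hd y
    exact LinearMap.congr_fun hψ x

end

variable {R S : Type u} [CommRing R] [CommRing S] [Algebra R S]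

theorem TensorProduct.linearMapLeftRight_equiv_lTensor_lcomp {G G' B : Type u}
    [AddCommGroup G] [Module R G] [AddCommGroup G'] [Module R G'] [AddCommGroup B] [Module R B]
    [Module.Free R G] [Module.Finite R G] [Module.Free R G'] [Module.Finite R G']
    (d : G' →ₗ[R] G) (x : S ⊗[R] (G →ₗ[R] B)) :
    (IsBaseChange.linearMapLeftRight (TensorProduct.isBaseChange R G' S)
        (TensorProduct.isBaseChange R B S)).equiv ((d.lcomp R B).lTensor S x) =
      (d.baseChange S).lcomp S (S ⊗[R] B)
        ((IsBaseChange.linearMapLeftRight (TensorProduct.isBaseChange R G S)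
          (TensorProduct.isBaseChange R B S)).equiv x) := by
  induction x with
  | zero => simp
  | add x y hx hy => simp only [map_add, hx, hy]
  | tmul s φ =>
    rw [LinearMap.lTensor_tmul, IsBaseChange.equiv_tmul, IsBaseChange.equiv_tmul]
    ext z
    have h₁ := IsBaseChange.linearMapLeftRightHom_comp_apply
      (TensorProduct.isBaseChange R G' S) (TensorProduct.mk R S B 1) (d.lcomp R B φ) z
    have h₂ := IsBaseChange.linearMapLeftRightHom_comp_apply
      (TensorProduct.isBaseChange R G S) (TensorProduct.mk R S B 1) φ (d z)
    simp only [TensorProduct.mk_apply] at h₁ h₂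
    simp [h₁, h₂]

/-- Dimension shifting reduces to degree one. There a presentation by finite free modules is used,
for which Hom commutes with base change. -/
theorem extVanishes_baseChange_iff [IsNoetherianRing R] [Module.FaithfullyFlat R S]
    {A B : Type u} [AddCommGroup A] [Module R A] [Module.Finite R A] [AddCommGroup B] [Module R B]
    {i : ℕ} (hi : 0 < i) :
    ExtVanishes S (S ⊗[R] A) (S ⊗[R] B) i ↔ ExtVanishes R A B i := by
  obtain ⟨i, rfl⟩ := Nat.exists_eq_succ_of_ne_zero hi.ne'
  clear hi
  induction i generalizing A with
  | zero =>
    obtain ⟨n, g, hg⟩ := Module.Finite.exists_fin' R A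
    obtain ⟨n₁, g₁, hg₁⟩ := Module.Finite.exists_fin' R (LinearMap.ker g)
    obtain ⟨n₂, g₂, hg₂⟩ := Module.Finite.exists_fin' R (LinearMap.ker g₁)
    let d₁ := (LinearMap.ker g).subtype ∘ₗ g₁
    let d₂ := (LinearMap.ker g₁).subtype ∘ₗ g₂
    have h₁ : Function.Exact d₁ g := by
      rw [LinearMap.exact_iff, LinearMap.range_comp, LinearMap.range_eq_top.mpr hg₁]
      simp
    have h₂ : Function.Exact d₂ d₁ := by
      rw [LinearMap.exact_iff, LinearMap.range_comp, LinearMap.range_eq_top.mpr hg₂,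
        LinearMap.ker_comp_of_ker_eq_bot _ (Submodule.ker_subtype _)]
      simp
    change ExtVanishes _ _ _ 1 ↔ ExtVanishes _ _ _ 1
    rw [extVanishes_one_iff_exact h₂ h₁ hg,
      extVanishes_one_iff_exact (g := g.baseChange S) (d₁ := d₁.baseChange S)
        (d₂ := d₂.baseChange S) (Module.Flat.lTensor_exact S h₂) (Module.Flat.lTensor_exact S h₁)
        (LinearMap.lTensor_surjective S hg), ← Module.FaithfullyFlat.lTensor_exact_iff_exact R S]
    exact (Function.Exact.iff_of_ladder_addEquiv
      (IsBaseChange.linearMapLeftRight (TensorProduct.isBaseChange R (Fin n → R) S)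
        (TensorProduct.isBaseChange R B S)).equiv.toAddEquiv
      (IsBaseChange.linearMapLeftRight (TensorProduct.isBaseChange R (Fin n₁ → R) S)
        (TensorProduct.isBaseChange R B S)).equiv.toAddEquiv
      (IsBaseChange.linearMapLeftRight (TensorProduct.isBaseChange R (Fin n₂ → R) S)
        (TensorProduct.isBaseChange R B S)).equiv.toAddEquiv
      (f₁₂ := ((d₁.lcomp R B).lTensor S).toAddMonoidHom)
      (f₂₃ := ((d₂.lcomp R B).lTensor S).toAddMonoidHom)
      (g₁₂ := ((d₁.baseChange S).lcomp S (S ⊗[R] B)).toAddMonoidHom)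
      (g₂₃ := ((d₂.baseChange S).lcomp S (S ⊗[R] B)).toAddMonoidHom)
      (AddMonoidHom.ext fun x ↦
        (TensorProduct.linearMapLeftRight_equiv_lTensor_lcomp d₁ x).symm)
      (AddMonoidHom.ext fun x ↦
        (TensorProduct.linearMapLeftRight_equiv_lTensor_lcomp d₂ x).symm))
  | succ i ih =>
    obtain ⟨n, g, hg⟩ := Module.Finite.exists_fin' R A
    have hk : Function.Exact (LinearMap.ker g).subtype g := fun x ↦ by simp
    rw [hk.extVanishes_add_two_iff (Submodule.subtype_injective _) hg,
      Function.Exact.extVanishes_add_two_iff (f := (LinearMap.ker g).subtype.baseChange S)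
        (g := g.baseChange S) (Module.Flat.lTensor_exact S hk)
        (Module.Flat.lTensor_preserves_injective_linearMap _ (Submodule.subtype_injective _))
        (LinearMap.lTensor_surjective S hg)]
    exact ih

end FlatBaseChange

/-! ### Complexes of free modules and their cones -/

/-- A complex of finite free modules in nonnegative degrees: the term of homological degree `i` is
`X (i + 1)`, and `X 0` is zero. The truncated subtraction makes `X 0` the target of `d 0`. -/
structure FreeComplex (S : Type u) [CommRing S] where
  X : ℕ → Type u
  [addCommGroup : ∀ i, AddCommGroup (X i)]
  [module : ∀ i, Module S (X i)]
  [finite : ∀ i, Module.Finite S (X i)]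
  [free : ∀ i, Module.Free S (X i)]
  d : ∀ i, X i →ₗ[S] X (i - 1)
  d_d : ∀ i x, d (i - 1) (d i x) = 0
  subsingleton : Subsingleton (X 0)

namespace FreeComplex

attribute [instance] addCommGroup module finite free

variable {S : Type u} [CommRing S] (P : FreeComplex S)

/-- The cokernel of the differential `d i`. -/
abbrev Coker (i : ℕ) : Type u := P.X (i - 1) ⧸ LinearMap.range (P.d i)

/-- Exactness at the target of the differential `d i`. -/
def ExactAt (i : ℕ) : Prop := ∀ z, P.d (i - 1) z = 0 → ∃ w, P.d i w = z

/-- The element `y` annihilates all homology modules. -/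
def KillsHomology (y : S) : Prop := ∀ i z, P.d (i - 1) z = 0 → ∃ w, P.d i w = y • z

/-- The mapping cone of multiplication by `x`. -/
@[reducible]
def cone (x : S) : FreeComplex S where
  X i := P.X i × P.X (i - 1)
  d i := (P.d i ∘ₗ .fst S _ _ + x • .snd S _ _).prod (-(P.d (i - 1) ∘ₗ .snd S _ _))
  d_d i := fun ⟨a, b⟩ ↦ by
    ext
    · simp [P.d_d i a]
    · simp [P.d_d (i - 1) b]
  subsingleton := by
    have := P.subsingleton
    exact inferInstanceAs (Subsingleton (P.X 0 × P.X 0))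

theorem cone_d_apply (x : S) (i : ℕ) (a : P.X i) (b : P.X (i - 1)) :
    (P.cone x).d i (a, b) = (P.d i a + x • b, -P.d (i - 1) b) := rfl

variable {P}

theorem exists_of_exactAt {x : S} {i : ℕ} (h : P.ExactAt i) {a : P.X (i - 1)} {b' : P.X (i - 1)}
    (hab : P.d (i - 1) a + x • P.d (i - 1) b' = 0) :
    ∃ w, (P.cone x).d i w = (a, P.d (i - 1) b') := by
  obtain ⟨a', ha'⟩ := h (a + x • b') (by simpa using hab)
  exact ⟨(a', -b'), by simp [ha']⟩

theorem ExactAt.cone {x : S} {i : ℕ} (h : P.ExactAt i) (h' : P.ExactAt (i - 1)) :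
    (P.cone x).ExactAt i := by
  rintro ⟨a, b⟩ hab
  rw [cone_d_apply, Prod.mk_eq_zero, neg_eq_zero] at hab
  obtain ⟨b', rfl⟩ := h' b hab.2
  exact exists_of_exactAt h hab.1

theorem KillsHomology.mul_left {y : S} (h : P.KillsHomology y) (r : S) :
    P.KillsHomology (r * y) := fun i z hz ↦ by
  obtain ⟨w, hw⟩ := h i z hz
  exact ⟨r • w, by rw [map_smul, hw, mul_smul]⟩

theorem KillsHomology.add {y y' : S} (h : P.KillsHomology y) (h' : P.KillsHomology y') :
    P.KillsHomology (y + y') := fun i z hz ↦ by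
  obtain ⟨w, hw⟩ := h i z hz
  obtain ⟨w', hw'⟩ := h' i z hz
  exact ⟨w + w', by rw [map_add, hw, hw', add_smul]⟩

/-- The map `(a, b) ↦ (0, a)` is a homotopy between multiplication by `x` and zero, up to sign
conventions. -/
theorem killsHomology_cone_self (x : S) : (P.cone x).KillsHomology x := by
  rintro i ⟨a, b⟩ hab
  rw [cone_d_apply, Prod.mk_eq_zero] at hab
  refine ⟨(0, a), ?_⟩
  rw [cone_d_apply, map_zero, zero_add, Prod.smul_mk, eq_neg_of_add_eq_zero_left hab.1, neg_neg]

/-- Homology of the cone is an extension of a submodule of one homology module of `P` by a quotient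
of another, hence the square. -/
theorem KillsHomology.cone {y : S} (h : P.KillsHomology y) (x : S) :
    (P.cone x).KillsHomology (y * y) := by
  rintro i ⟨a, b⟩ hab
  rw [cone_d_apply, Prod.mk_eq_zero, neg_eq_zero] at hab
  obtain ⟨b', hb'⟩ := h (i - 1) b hab.2
  obtain ⟨a', ha'⟩ := h i (y • a + x • b') (by
    rw [map_add, map_smul, map_smul, hb', smul_comm x y, ← smul_add, hab.1, smul_zero])
  refine ⟨(a', -(y • b')), ?_⟩
  rw [cone_d_apply, ha', map_neg, neg_neg, map_smul, hb', Prod.smul_mk, mul_smul, mul_smul]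
  congr 1
  rw [smul_neg, smul_comm x y, smul_add, add_neg_cancel_right]

variable (P) in
/-- The inclusion of the cokernel of the differential of the cone. -/
def cokerConeMap (x : S) (t : ℕ) : (P.cone x).Coker (t + 1) →ₗ[S] P.X (t - 1) × P.Coker t :=
  (LinearMap.range ((P.cone x).d (t + 1))).liftQ
    ((P.d t ∘ₗ .fst S (P.X t) (P.X (t - 1)) + x • .snd S (P.X t) (P.X (t - 1))).prod
      ((LinearMap.range (P.d t)).mkQ ∘ₗ .snd S (P.X t) (P.X (t - 1)))) (by
    rintro _ ⟨⟨a, b⟩, rfl⟩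
    change (P.d t (P.d (t + 1) a + x • b) + x • (-P.d t b), Submodule.Quotient.mk (-P.d t b)) = 0
    have : P.d t (P.d (t + 1) a) = 0 := P.d_d (t + 1) a
    ext
    · simp [this]
    · simp)

theorem cokerConeMap_mk (x : S) (t : ℕ) (a : P.X t) (b : P.X (t - 1)) :
    P.cokerConeMap x t (Submodule.Quotient.mk (a, b)) =
      (P.d t a + x • b, Submodule.Quotient.mk b) := rfl

variable (P) in
/-- The projection with kernel the cokernel of the differential of the cone. -/
def cokerConeProj (x : S) (t : ℕ) : P.X (t - 1) × P.Coker t →ₗ[S] P.Coker t :=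
  (LinearMap.range (P.d t)).mkQ ∘ₗ .fst S _ _ - x • .snd S _ _

theorem cokerConeMap_injective {x : S} {t : ℕ} (h : P.ExactAt (t + 1)) :
    Function.Injective (P.cokerConeMap x t) := by
  rw [injective_iff_map_eq_zero]
  intro z hz
  obtain ⟨⟨a, b⟩, rfl⟩ := Submodule.Quotient.mk_surjective _ z
  rw [cokerConeMap_mk, Prod.mk_eq_zero, Submodule.Quotient.mk_eq_zero] at hz
  obtain ⟨hab, b', rfl⟩ := hz
  rw [Submodule.Quotient.mk_eq_zero]
  exact exists_of_exactAt (x := x) h hab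

theorem exact_cokerCone (x : S) (t : ℕ) :
    Function.Exact (P.cokerConeMap x t) (P.cokerConeProj x t) := by
  rintro ⟨p, c⟩
  obtain ⟨b, rfl⟩ := Submodule.Quotient.mk_surjective _ c
  refine ⟨fun h ↦ ?_, ?_⟩
  · have h' : (Submodule.Quotient.mk (p - x • b) : P.Coker t) = 0 := h
    rw [Submodule.Quotient.mk_eq_zero] at h'
    obtain ⟨a, ha⟩ := h'
    exact ⟨Submodule.Quotient.mk (a, b), by rw [cokerConeMap_mk, ha, sub_add_cancel]⟩
  · rintro ⟨z, hz⟩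
    obtain ⟨⟨a, b'⟩, rfl⟩ := Submodule.Quotient.mk_surjective _ z
    change P.X t at a
    change P.X (t - 1) at b'
    rw [← hz, cokerConeMap_mk]
    change (Submodule.Quotient.mk (P.d t a + x • b' - x • b') : P.Coker t) = 0
    rw [add_sub_cancel_right, Submodule.Quotient.mk_eq_zero]
    exact ⟨a, rfl⟩

theorem cokerConeProj_surjective (x : S) (t : ℕ) : Function.Surjective (P.cokerConeProj x t) :=
  fun c ↦ by
    obtain ⟨b, rfl⟩ := Submodule.Quotient.mk_surjective _ c
    exact ⟨(b, 0), by simp [cokerConeProj]⟩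

theorem hasTopSelfExt_coker_cone [IsNoetherianRing S] {x : S} (hx : x ∈ (⊥ : Ideal S).jacobson)
    {t s : ℕ} (h : P.ExactAt (t + 1)) (hP : HasTopSelfExt S (P.Coker t) s) :
    HasTopSelfExt S ((P.cone x).Coker (t + 1)) (s + 1) :=
  .of_exact (exact_cokerCone x t) (cokerConeMap_injective h) (cokerConeProj_surjective x t)
    (neg_mem hx) (by ext; simp [cokerConeProj]) hP

section Resolution

variable [IsNoetherianRing S] {M : Type u} [AddCommGroup M] [Module S M] [Module.Finite S M]

theorem exists_syzygies (n₀ : ℕ) (K₀ : Submodule S (Fin n₀ → S)) :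
    ∃ (n : ℕ → ℕ) (c : ∀ i, (Fin (n (i + 1)) → S) →ₗ[S] (Fin (n i) → S)) (e : n 0 = n₀),
      (∀ i, LinearMap.ker (c i) = LinearMap.range (c (i + 1))) ∧
      e ▸ LinearMap.range (c 0) = K₀ := by
  have step : ∀ K : Σ n : ℕ, Submodule S (Fin n → S), ∃ (K' : Σ n : ℕ, Submodule S (Fin n → S))
      (c : (Fin K'.1 → S) →ₗ[S] (Fin K.1 → S)), LinearMap.range c = K.2 ∧
        LinearMap.ker c = K'.2 := fun K ↦ by
    obtain ⟨n, f, hf⟩ := Module.Finite.exists_fin' S K.2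
    refine ⟨⟨n, LinearMap.ker f⟩, K.2.subtype ∘ₗ f, ?_,
      LinearMap.ker_comp_of_ker_eq_bot _ (Submodule.ker_subtype _)⟩
    rw [LinearMap.range_comp, LinearMap.range_eq_top.mpr hf]
    simp
  choose next c hr hk using step
  let K : ℕ → Σ n : ℕ, Submodule S (Fin n → S) := Nat.rec ⟨n₀, K₀⟩ fun _ ↦ next
  exact ⟨fun i ↦ (K i).1, fun i ↦ c (K i), rfl,
    fun i ↦ (hk (K i)).trans (hr (K (i + 1))).symm, hr (K 0)⟩

/-- The rank of the `i`-th term of a complex of free modules of ranks `n`, shifted by one. -/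
abbrev shiftedRank (n : ℕ → ℕ) : ℕ → ℕ
  | 0 => 0
  | i + 1 => n i

/-- The differential of a shifted complex of free modules. -/
def shiftedD {n : ℕ → ℕ} (c : ∀ i, (Fin (n (i + 1)) → S) →ₗ[S] (Fin (n i) → S)) :
    ∀ i, (Fin (shiftedRank n i) → S) →ₗ[S] (Fin (shiftedRank n (i - 1)) → S)
  | 0 => 0
  | 1 => 0
  | i + 2 => c i

variable (M) in
theorem exists_resolution : ∃ P : FreeComplex S, (∀ i, 2 < i → P.ExactAt i) ∧
    Nonempty (M ≃ₗ[S] P.Coker 2) := by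
  obtain ⟨n, f, hf⟩ := Module.Finite.exists_fin' S M
  obtain ⟨n, c, rfl, hc, hc₀⟩ := exists_syzygies n (LinearMap.ker f)
  let P : FreeComplex S :=
    { X i := Fin (shiftedRank n i) → S
      d := shiftedD c
      d_d
      | 0, _ => rfl
      | 1, _ => rfl
      | 2, _ => rfl
      | i + 3, x => show c (i + 1) x ∈ LinearMap.ker (c i) from hc i ▸ ⟨x, rfl⟩
      subsingleton := inferInstanceAs (Subsingleton (Fin 0 → S)) }
  refine ⟨P, fun i hi ↦ ?_, ⟨(f.quotKerEquivOfSurjective hf).symm.trans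
    (Submodule.quotEquivOfEq _ _ hc₀.symm)⟩⟩
  obtain ⟨i, rfl⟩ := Nat.exists_eq_add_of_lt hi
  rw [show 2 + i + 1 = i + 3 by lia]
  intro z hz
  have : z ∈ LinearMap.range (c (i + 1)) := hc i ▸ hz
  exact this

end Resolution

/-- One cone per element of `l`. Each raises by one both the bound `t` beyond which the complex is
exact and the top degree. -/
theorem exists_hasTopSelfExt_killsHomology [IsNoetherianRing S] {M : Type u} [AddCommGroup M]
    [Module S M] [Module.Finite S M] {s : ℕ} (hM : HasTopSelfExt S M s) (l : List S)
    (hl : ∀ x ∈ l, x ∈ (⊥ : Ideal S).jacobson) :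
    ∃ (P : FreeComplex S) (t s' : ℕ), (∀ i, t < i → P.ExactAt i) ∧
      HasTopSelfExt S (P.Coker t) s' ∧ ∀ x ∈ l, ∃ k : ℕ, P.KillsHomology (x ^ k) := by
  induction l with
  | nil =>
    obtain ⟨P, hP, ⟨e⟩⟩ := exists_resolution (S := S) M
    exact ⟨P, 2, s, hP, hM.congr e, by simp⟩
  | cons x l ih =>
    obtain ⟨P, t, s', hP, hs, hk⟩ := ih fun y hy ↦ hl y (List.mem_cons_of_mem _ hy)
    refine ⟨P.cone x, t + 1, s' + 1, fun i hi ↦ (hP i (by lia)).cone (hP _ (by lia)),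
      hasTopSelfExt_coker_cone (hl x List.mem_cons_self) (hP _ (by lia)) hs, fun y hy ↦ ?_⟩
    rcases List.mem_cons.mp hy with rfl | hy
    · exact ⟨1, by simpa using killsHomology_cone_self y⟩
    · obtain ⟨k, hk⟩ := hk y hy
      exact ⟨k + k, by simpa [pow_add] using hk.cone x⟩

end FreeComplex

/-! ### Modules extended from the base ring -/

section Descent

open TensorProduct

/-- The `S`-module `C` is extended from a finitely generated `R`-module. -/
def IsExtended (R : Type u) {S : Type u} [CommRing R] [CommRing S] [Algebra R S] (C : Type u)
    [AddCommGroup C] [Module S C] : Prop :=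
  ∃ (D : Type u) (_ : AddCommGroup D) (_ : Module R D) (_ : Module.Finite R D),
    Nonempty (S ⊗[R] D ≃ₗ[S] C)

/-- The `S`-module `C` is extended from a finitely generated `R`-module after adding a finite free
summand. -/
def IsStablyExtended (R : Type u) {S : Type u} [CommRing R] [CommRing S] [Algebra R S] (C : Type u)
    [AddCommGroup C] [Module S C] : Prop :=
  ∃ n : ℕ, IsExtended R (S := S) (C × (Fin n → S))

variable {R S : Type u} [CommRing R] [CommRing S] [Algebra R S]
  {C B P Q : Type u} [AddCommGroup C] [Module S C] [AddCommGroup B] [Module S B]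
  [AddCommGroup P] [Module S P] [AddCommGroup Q] [Module S Q]

theorem IsExtended.congr (e : C ≃ₗ[S] B) : IsExtended R (S := S) C → IsExtended R (S := S) B :=
  fun ⟨D, _, _, _, ⟨f⟩⟩ ↦ ⟨D, _, _, ‹_›, ⟨f.trans e⟩⟩

theorem IsExtended.prod : IsExtended R (S := S) C → IsExtended R (S := S) B →
    IsExtended R (S := S) (C × B) :=
  fun ⟨D, _, _, _, ⟨f⟩⟩ ⟨E, _, _, _, ⟨g⟩⟩ ↦
    ⟨D × E, inferInstance, inferInstance, inferInstance,
      ⟨(TensorProduct.prodRight R S S D E).trans (f.prodCongr g)⟩⟩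

theorem IsExtended.pi (n : ℕ) : IsExtended R (S := S) (Fin n → S) :=
  ⟨Fin n → R, inferInstance, inferInstance, inferInstance,
    ⟨TensorProduct.piScalarRight R S S (Fin n)⟩⟩

theorem IsExtended.of_free [Module.Finite S P] [Module.Free S P] : IsExtended R (S := S) P :=
  (IsExtended.pi _).congr
    ((Module.Free.chooseBasis S P).reindex (Fintype.equivFin _)).equivFun.symm

theorem IsExtended.isStablyExtended (h : IsExtended R (S := S) C) :
    IsStablyExtended R (S := S) C :=
  ⟨0, h.prod (.pi 0)⟩

/-- Schanuel's lemma. -/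
theorem nonempty_ker_prod_equiv_prod_ker [Module.Projective S P] [Module.Projective S Q]
    {π : P →ₗ[S] C} {σ : Q →ₗ[S] C} (hπ : Function.Surjective π) (hσ : Function.Surjective σ) :
    Nonempty ((LinearMap.ker π × Q) ≃ₗ[S] (P × LinearMap.ker σ)) := by
  obtain ⟨l, hl⟩ := Module.projective_lifting_property π σ hπ
  obtain ⟨m, hm⟩ := Module.projective_lifting_property σ π hσ
  have hl' : ∀ q, π (l q) = σ q := LinearMap.congr_fun hl
  have hm' : ∀ p, σ (m p) = π p := LinearMap.congr_fun hm
  exact ⟨{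
    toFun x := (x.1 + l x.2, ⟨x.2 - m (x.1 + l x.2), by simp [hm', hl']⟩)
    map_add' x y := by
      ext
      · simp only [Prod.fst_add, Prod.snd_add, Submodule.coe_add, map_add]; abel
      · simp only [Prod.fst_add, Prod.snd_add, Submodule.coe_add, map_add]; abel
    map_smul' r x := by
      ext <;> simp [smul_sub, smul_add]
    invFun y := (⟨y.1 - l (y.2 + m y.1), by simp [hm', hl']⟩, y.2 + m y.1)
    left_inv x := by ext <;> simp
    right_inv y := by ext <;> simp }⟩

/-- By flatness, the base change of a free cover of `D` has an extended kernel; Schanuel's lemma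
compares it with `π`. -/
theorem isStablyExtended_ker_of_surjective [IsNoetherianRing R] [Module.Flat R S] {D : Type u}
    [AddCommGroup D] [Module R D] [Module.Finite R D] [Module.Finite S P] [Module.Free S P]
    {π : P →ₗ[S] S ⊗[R] D} (hπ : Function.Surjective π) :
    IsStablyExtended R (S := S) (LinearMap.ker π) := by
  obtain ⟨n, σ, hσ⟩ := Module.Finite.exists_fin' R D
  have hσ' : Function.Surjective (AlgebraTensorModule.map (.id : S →ₗ[S] S) σ) :=
    LinearMap.lTensor_surjective S hσ
  obtain ⟨e⟩ := nonempty_ker_prod_equiv_prod_ker hπ hσ'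
  refine ⟨n, IsExtended.congr (((LinearEquiv.refl S P).prodCongr
    (LinearMap.tensorKerEquiv S S σ)).trans (e.symm.trans ((LinearEquiv.refl S _).prodCongr
      (TensorProduct.piScalarRight R S S (Fin n))))) (IsExtended.of_free.prod ?_)⟩
  exact ⟨LinearMap.ker σ, inferInstance, inferInstance, inferInstance, ⟨.refl S _⟩⟩

theorem IsStablyExtended.ker [IsNoetherianRing R] [Module.Flat R S] [Module.Finite S P]
    [Module.Free S P] {π : P →ₗ[S] C} (hπ : Function.Surjective π)
    (h : IsStablyExtended R (S := S) C) : IsStablyExtended R (S := S) (LinearMap.ker π) := by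
  obtain ⟨n, D, _, _, _, ⟨e⟩⟩ := h
  let π' : P × (Fin n → S) →ₗ[S] S ⊗[R] D := e.symm.toLinearMap ∘ₗ π.prodMap .id
  have hπ' : Function.Surjective π' :=
    e.symm.surjective.comp (hπ.prodMap Function.surjective_id)
  obtain ⟨k, hk⟩ := isStablyExtended_ker_of_surjective hπ'
  have hmem : ∀ x, x ∈ LinearMap.ker π' ↔ π x.1 = 0 ∧ x.2 = 0 := fun x ↦ by
    simp [π']
  let f : LinearMap.ker π' ≃ₗ[S] LinearMap.ker π :=
    { toFun x := ⟨x.1.1, ((hmem _).mp x.2).1⟩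
      map_add' _ _ := rfl
      map_smul' _ _ := rfl
      invFun y := ⟨(y.1, 0), (hmem _).mpr ⟨y.2, rfl⟩⟩
      left_inv x := Subtype.ext (Prod.ext rfl ((hmem _).mp x.2).2.symm)
      right_inv _ := rfl }
  exact ⟨k, hk.congr (f.prodCongr (.refl S _))⟩

section Torsion

variable {I : Ideal R} (hI : ∀ s : S, ∃ r : R, s - algebraMap R S r ∈ I.map (algebraMap R S))
include hI

/-- On an `I`-torsion module only `S/IS` matters, and `R` surjects onto it. -/
theorem exists_one_tmul_eq {H : Type*} [AddCommGroup H] [Module R H]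
    (hH : ∀ r ∈ I, ∀ z : H, r • z = 0) (w : S ⊗[R] H) : ∃ z : H, w = 1 ⊗ₜ z := by
  induction w with
  | zero => exact ⟨0, by simp⟩
  | add x y hx hy =>
    obtain ⟨a, rfl⟩ := hx
    obtain ⟨b, rfl⟩ := hy
    exact ⟨a + b, by rw [tmul_add]⟩
  | tmul s z =>
    obtain ⟨r, hr⟩ := hI s
    have key : ∀ j ∈ I.map (algebraMap R S), (j ⊗ₜ[R] z : S ⊗[R] H) = 0 := fun j hj ↦ by
      induction hj using Submodule.span_induction with
      | mem x hx =>
        obtain ⟨i, hi, rfl⟩ := hx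
        rw [Algebra.algebraMap_eq_smul_one, smul_tmul, hH i hi, tmul_zero]
      | zero => rw [zero_tmul]
      | add x y _ _ hx hy => rw [add_tmul, hx, hy, add_zero]
      | smul a x _ hx => rw [← smul_tmul', hx, smul_zero]
    refine ⟨r • z, ?_⟩
    rw [← sub_add_cancel s (algebraMap R S r), add_tmul, key _ hr, zero_add,
      Algebra.algebraMap_eq_smul_one, smul_tmul]

theorem exists_smul_eq_algebraMap_smul (s : S) : ∃ r : R, ∀ z : C,
    (∀ i ∈ I, algebraMap R S i • z = 0) → s • z = algebraMap R S r • z := by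
  obtain ⟨r, hr⟩ := hI s
  refine ⟨r, fun z hz ↦ ?_⟩
  have key : ∀ j ∈ I.map (algebraMap R S), j • z = 0 := fun j hj ↦ by
    induction hj using Submodule.span_induction with
    | mem x hx =>
      obtain ⟨i, hi, rfl⟩ := hx
      exact hz i hi
    | zero => rw [zero_smul]
    | add x y _ _ hx hy => rw [add_smul, hx, hy, add_zero]
    | smul a x _ hx => rw [smul_assoc, hx, smul_zero]
  rw [← sub_eq_zero, ← sub_smul, key _ hr]

/-- With `B` extended from `D`, the module `C` is extended from the fibre product `E` of `C` and `D`
over `B`. The kernel of `E → D` is that of `g`, which base change to `S` does not enlarge, as it is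
killed by `I`. -/
theorem IsExtended.of_surjective_of_ker [IsNoetherianRing R] [IsNoetherianRing S]
    [Module.Finite S C] {g : C →ₗ[S] B} (hg : Function.Surjective g)
    (hk : ∀ r ∈ I, ∀ z, g z = 0 → algebraMap R S r • z = 0) (h : IsExtended R (S := S) B) :
    IsExtended R (S := S) C := by
  obtain ⟨D, _, _, _, ⟨e⟩⟩ := h
  let : Module R C := Module.compHom C (algebraMap R S)
  have hsmul : ∀ (r : R) (c : C), r • c = algebraMap R S r • c := fun _ _ ↦ rfl
  have : IsScalarTower R S C := .of_algebraMap_smul fun _ _ ↦ rfl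
  let E : Submodule R (C × D) :=
    { carrier := {p | g p.1 = e (1 ⊗ₜ p.2)}
      add_mem' {p q} hp hq := by
        simp only [Set.mem_ofPred_eq] at hp hq ⊢
        simp [hp, hq, tmul_add]
      zero_mem' := by simp
      smul_mem' r p hp := by
        simp only [Set.mem_ofPred_eq] at hp ⊢
        rw [Prod.smul_fst, hsmul, map_smul, hp, Prod.smul_snd, tmul_smul, ← map_smul,
          algebraMap_smul] }
  have hE : ∀ p, p ∈ E ↔ g p.1 = e (1 ⊗ₜ p.2) := fun _ ↦ Iff.rfl
  let p : E →ₗ[R] D := .snd R C D ∘ₗ E.subtype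
  have hp : Function.Surjective p := fun d ↦ by
    obtain ⟨c, hc⟩ := hg (e (1 ⊗ₜ d))
    exact ⟨⟨(c, d), hc⟩, rfl⟩
  have hpk : ∀ x : E, p x = 0 → g x.1.1 = 0 := fun x hx ↦ by
    rw [x.2, show x.1.2 = 0 from hx, tmul_zero, map_zero]
  let φ : S ⊗[R] E →ₗ[S] C := (LinearMap.fst R C D ∘ₗ E.subtype).liftBaseChange S
  have hφ : ∀ s (x : E), φ (s ⊗ₜ x) = s • x.1.1 := fun s x ↦ by simp [φ]
  have hgφ : ∀ w, g (φ w) = e (p.lTensor S w) := fun w ↦ by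
    induction w with
    | zero => simp
    | add x y hx hy => simp only [map_add, hx, hy]
    | tmul s x =>
      rw [hφ, map_smul, x.2, ← map_smul, smul_tmul', smul_eq_mul, mul_one, LinearMap.lTensor_tmul]
      rfl
  have hfin : Module.Finite R E := by
    rw [Module.Finite.iff_fg]
    refine Submodule.fg_of_fg_map_of_fg_inf_ker (.snd R C D) (IsNoetherian.noetherian _) ?_
    -- Generators of `ker g` over `S` also generate it over `R`, because each scalar of `S` acts on
    -- it as some scalar of `R`.
    obtain ⟨T, hT⟩ := IsNoetherian.noetherian (LinearMap.ker g)
    have hle : Submodule.span R (T : Set C) ≤ (LinearMap.ker g).restrictScalars R :=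
      Submodule.span_le.mpr fun x hx ↦ hT ▸ Submodule.subset_span hx
    have heq : Submodule.span R (T : Set C) = (LinearMap.ker g).restrictScalars R := by
      refine le_antisymm hle fun z hz ↦ ?_
      rw [Submodule.restrictScalars_mem, ← hT] at hz
      induction hz using Submodule.span_induction with
      | mem x hx => exact Submodule.subset_span hx
      | zero => exact zero_mem _
      | add x y _ _ hx hy => exact add_mem hx hy
      | smul s x _ hx =>
        obtain ⟨r, hr⟩ := exists_smul_eq_algebraMap_smul (C := C) hI s
        rw [hr x fun i hi ↦ hk i hi x (hle hx)]
        exact Submodule.smul_mem _ r hx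
    have hmap : E ⊓ LinearMap.ker (.snd R C D) =
        (Submodule.span R (T : Set C)).map (.inl R C D) := by
      rw [heq]
      ext ⟨c, d⟩
      simp only [Submodule.mem_inf, LinearMap.mem_ker, LinearMap.snd_apply, Submodule.mem_map,
        Submodule.restrictScalars_mem, LinearMap.inl_apply, Prod.mk.injEq]
      constructor
      · rintro ⟨hc, rfl⟩
        exact ⟨c, by rw [(hE _).mp hc]; simp, rfl, rfl⟩
      · rintro ⟨c', hc', rfl, rfl⟩
        exact ⟨(hE _).mpr (by simp [hc']), rfl⟩
    rw [hmap]
    exact (Submodule.fg_span T.finite_toSet).map _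
  refine ⟨E, inferInstance, inferInstance, hfin, ⟨.ofBijective φ ⟨?_, fun c ↦ ?_⟩⟩⟩
  · rw [injective_iff_map_eq_zero]
    intro w hw
    have hw' : p.lTensor S w = 0 := e.injective (by rw [← hgφ, hw, map_zero, map_zero])
    have hex : Function.Exact (LinearMap.ker p).subtype p := fun x ↦ by simp
    obtain ⟨v, rfl⟩ := (lTensor_exact (R := R) (M := LinearMap.ker p) (N := E) (P := D)
      (f := (LinearMap.ker p).subtype) (g := p) S hex hp w).mp hw'
    obtain ⟨z, rfl⟩ := exists_one_tmul_eq hI (H := LinearMap.ker p) (fun r hr z ↦ by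
      refine Subtype.ext (Subtype.ext (Prod.ext (hk r hr _ (hpk _ z.2)) ?_))
      change r • z.1.1.2 = 0
      rw [show z.1.1.2 = 0 from z.2, smul_zero]) v
    rw [LinearMap.lTensor_tmul, hφ, one_smul] at hw
    rw [show z = 0 from Subtype.ext (Subtype.ext (Prod.ext hw z.2))]
    simp
  · obtain ⟨w, hw⟩ := LinearMap.lTensor_surjective S hp (e.symm (g c))
    have hz : g (c - φ w) = 0 := by rw [map_sub, hgφ, hw, e.apply_symm_apply, sub_self]
    refine ⟨1 ⊗ₜ ⟨(c - φ w, 0), (hE _).mpr (by simp [hz])⟩ + w, ?_⟩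
    rw [map_add, hφ, one_smul, sub_add_cancel]

theorem IsStablyExtended.of_surjective_of_ker [IsNoetherianRing R] [IsNoetherianRing S]
    [Module.Finite S C] {g : C →ₗ[S] B} (hg : Function.Surjective g)
    (hk : ∀ r ∈ I, ∀ z, g z = 0 → algebraMap R S r • z = 0) (h : IsStablyExtended R (S := S) B) :
    IsStablyExtended R (S := S) C := by
  obtain ⟨n, h⟩ := h
  refine ⟨n, IsExtended.of_surjective_of_ker hI (g := g.prodMap .id)
    (hg.prodMap Function.surjective_id) (fun r hr z hz ↦ ?_) h⟩
  obtain ⟨h₁, h₂⟩ := Prod.mk_eq_zero.mp (show (g z.1, z.2) = 0 from hz)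
  exact Prod.ext (hk r hr _ h₁) (by rw [Prod.smul_snd, h₂, smul_zero]; rfl)

/-- Induction from the zero module at the bottom: each cokernel surjects onto a syzygy of the
previous one, with kernel a homology module. -/
theorem FreeComplex.isStablyExtended_coker [IsNoetherianRing R] [IsNoetherianRing S]
    [Module.Flat R S] (P : FreeComplex S) (hP : ∀ r ∈ I, P.KillsHomology (algebraMap R S r))
    (i : ℕ) : IsStablyExtended R (S := S) (P.Coker i) := by
  induction i with
  | zero =>
    have : Subsingleton (P.X (0 - 1)) := P.subsingleton
    have : Subsingleton (P.Coker 0) :=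
      (Submodule.Quotient.mk_surjective (LinearMap.range (P.d 0))).subsingleton
    exact IsExtended.isStablyExtended .of_free
  | succ i ih =>
    let g : P.Coker (i + 1) →ₗ[S] LinearMap.ker (LinearMap.range (P.d i)).mkQ :=
      (LinearMap.range (P.d (i + 1))).liftQ
        ((P.d i).codRestrict _ fun x ↦ by simp) (by
        rintro _ ⟨x, rfl⟩
        exact Subtype.ext (P.d_d (i + 1) x))
    refine IsStablyExtended.of_surjective_of_ker hI (g := g) ?_ ?_
      (ih.ker (Submodule.mkQ_surjective _))
    · rintro ⟨y, hy⟩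
      rw [Submodule.ker_mkQ] at hy
      obtain ⟨x, rfl⟩ := hy
      exact ⟨Submodule.Quotient.mk x, rfl⟩
    · intro r hr z hz
      obtain ⟨x, rfl⟩ := Submodule.Quotient.mk_surjective _ z
      obtain ⟨w, hw⟩ := hP r hr (i + 1) x (congrArg Subtype.val hz)
      rw [← Submodule.Quotient.mk_smul, Submodule.Quotient.mk_eq_zero]
      exact ⟨w, hw⟩

end Torsion

end Descent

/-! ### Transfer of (SAC) between a ring and its completion -/

section Completion

open TensorProduct IsLocalRing

variable {R S : Type u} [CommRing R] [CommRing S] [Algebra R S]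

theorem extVanishes_baseChange_self_iff [IsNoetherianRing R] [Module.FaithfullyFlat R S]
    {A : Type u} [AddCommGroup A] [Module R A] [Module.Finite R A] {i : ℕ} (hi : 0 < i) :
    ExtVanishes S (S ⊗[R] A) S i ↔ ExtVanishes R A R i := by
  rw [← extVanishes_baseChange_iff (R := R) (S := S) hi]
  exact ⟨.congr (.refl S _) (AlgebraTensorModule.rid R S S).symm,
    .congr (.refl S _) (AlgebraTensorModule.rid R S S)⟩

theorem SatisfiesSAC.of_faithfullyFlat [IsNoetherianRing R] [Module.FaithfullyFlat R S]
    (h : SatisfiesSAC S) : SatisfiesSAC R := by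
  rintro M _ _ _ hR ⟨n, hM⟩ i hi
  exact (extVanishes_baseChange_iff (S := S) hi).mp <| h (S ⊗[R] M)
    (fun j hj ↦ (extVanishes_baseChange_self_iff hj).mpr (hR j hj))
    ⟨n, fun j hj ↦ (extVanishes_baseChange_iff (n.zero_le.trans_lt hj)).mpr (hM j hj)⟩ i hi

theorem SatisfiesSAC.not_hasTopSelfExt (h : SatisfiesSAC R) {M : Type u} [AddCommGroup M]
    [Module R M] [Module.Finite R M] {s : ℕ} : ¬ HasTopSelfExt R M s :=
  fun hM ↦ hM.top (h M hM.ring ⟨s, hM.above⟩ s hM.pos)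

theorem satisfiesSAC_of_forall_not_hasTopSelfExt
    (h : ∀ (M : Type u) [AddCommGroup M] [Module R M] [Module.Finite R M] (s : ℕ),
      ¬ HasTopSelfExt R M s) : SatisfiesSAC R := by
  classical
  rintro M _ _ _ hR ⟨n, hM⟩ i hi
  by_contra hi'
  have hin : i ≤ n := not_lt.mp fun hlt ↦ hi' (hM i hlt)
  let p : ℕ → Prop := fun j ↦ 0 < j ∧ ¬ ExtVanishes R M M j
  obtain ⟨hpos, htop⟩ : p (Nat.findGreatest p n) := Nat.findGreatest_spec hin ⟨hi, hi'⟩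
  refine h M (Nat.findGreatest p n) ⟨hpos, hR, fun j hj ↦ ?_, htop⟩
  by_contra hj'
  rcases le_or_gt j n with hjn | hjn
  · exact Nat.findGreatest_is_greatest hj hjn ⟨hpos.trans hj, hj'⟩
  · exact hj' (hM j hjn)

theorem HasTopSelfExt.of_baseChange [IsNoetherianRing R] [Module.FaithfullyFlat R S]
    {A : Type u} [AddCommGroup A] [Module R A] [Module.Finite R A] {s : ℕ}
    (h : HasTopSelfExt S (S ⊗[R] A) s) : HasTopSelfExt R A s where
  pos := h.pos
  ring i hi := (extVanishes_baseChange_self_iff hi).mp (h.ring i hi)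
  above i hi := (extVanishes_baseChange_iff (h.pos.trans hi)).mp (h.above i hi)
  top h' := h.top ((extVanishes_baseChange_iff h.pos).mpr h')

theorem SatisfiesSAC.adicCompletion [IsNoetherianRing R] [IsLocalRing R] (h : SatisfiesSAC R) :
    SatisfiesSAC (AdicCompletion (maximalIdeal R) R) := by
  have := AdicCompletion.isNoetherianRing_of_isLocalRing R
  have := AdicCompletion.faithfullyFlat_of_isLocalRing R
  let S := AdicCompletion (maximalIdeal R) R
  refine satisfiesSAC_of_forall_not_hasTopSelfExt fun M _ _ _ s hM ↦ ?_
  obtain ⟨T, hT⟩ := (maximalIdeal R).fg_of_isNoetherianRing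
  obtain ⟨P, t, s', -, hs', hP⟩ := FreeComplex.exists_hasTopSelfExt_killsHomology hM
    (T.toList.map (algebraMap R S)) (by
      intro y hy
      obtain ⟨x, hx, rfl⟩ := List.mem_map.mp hy
      refine maximalIdeal_le_jacobson (⊥ : Ideal S) ?_
      rw [AdicCompletion.maximalIdeal_eq_map]
      exact Ideal.mem_map_of_mem _ (hT.le (Ideal.subset_span (Finset.mem_toList.mp hx))))
  -- The scalars of `R` killing homology form an ideal containing a power of each generator of the
  -- maximal ideal, hence a power of the maximal ideal.
  let J : Ideal R :=
    { carrier := {r | P.KillsHomology (algebraMap R S r)}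
      add_mem' {a b} ha hb := by
        rw [Set.mem_ofPred_eq, map_add]
        exact FreeComplex.KillsHomology.add ha hb
      zero_mem' := fun i z _ ↦ ⟨0, by simp⟩
      smul_mem' r a ha := by
        rw [Set.mem_ofPred_eq, smul_eq_mul, map_mul]
        exact FreeComplex.KillsHomology.mul_left ha _ }
  have hJ : maximalIdeal R ≤ J.radical := by
    rw [← hT, Ideal.span_le]
    intro x hx
    obtain ⟨k, hk⟩ := hP _ (List.mem_map_of_mem (Finset.mem_toList.mpr hx))
    refine ⟨k, ?_⟩
    change P.KillsHomology (algebraMap R S (x ^ k))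
    rwa [map_pow]
  obtain ⟨k, hk⟩ := Ideal.exists_pow_le_of_le_radical_of_fg hJ
    (maximalIdeal R).fg_of_isNoetherianRing
  obtain ⟨n, D, _, _, _, ⟨e⟩⟩ := FreeComplex.isStablyExtended_coker
    (AdicCompletion.exists_sub_algebraMap_mem_map_pow R k) P (fun r hr ↦ hk hr) t
  exact h.not_hasTopSelfExt (hs'.prod_free.congr e.symm).of_baseChange

end Completion

/-- A Noetherian local ring satisfies (SAC) iff its completion with respect to the maximal ideal
does. -/
theorem corollary3p9 (R : Type*) [CommRing R] [IsNoetherianRing R] [IsLocalRing R] :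
    SatisfiesSAC R ↔ SatisfiesSAC (AdicCompletion (IsLocalRing.maximalIdeal R) R) := by
  have := AdicCompletion.faithfullyFlat_of_isLocalRing R
  exact ⟨.adicCompletion, .of_faithfullyFlat⟩
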